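/- Let $G$ be a simple planar graph on $11$ vertices that contains no cycle of length $4$ as a (not necessarily induced) subgraph. Then the complement $G^c$ of $G$ contains a (not necessarily induced) subgraph isomorphic to the wheel $W_7$, where $W_n$ denotes the graph on $n+1$ vertices that consists of a cycle $C_n$ of length $n$ together with one further vertex (the hub) adjacent to every vertex of $C_n$. -/

import Mathlib

namespace SimpleGraph

/-- The wheel `W_n` (for `n ≥ 3`): a cycle `C_n` on the vertices `some i`, together with a hub
`none` adjacent to every vertex of that cycle. It has `n + 1` vertices. -/
def wheelGraph (n : ℕ) : SimpleGraph (Option (Fin n)) where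
  Adj
    | none, none => False
    | none, some _ => True
    | some _, none => True
    | some i, some j => (cycleGraph n).Adj i j
  symm := ⟨by
    rintro (_ | i) (_ | j) h
    · exact h
    · trivial
    · trivial
    · exact SimpleGraph.Adj.symm h⟩
  loopless := ⟨by
    rintro (_ | i) h
    · exact h
    · exact (cycleGraph n).loopless.irrefl i h⟩

/-- A drawing without crossings of a graph in the Euclidean plane: the vertices are distinct points,
every edge is a simple (injective, continuous) arc joining its two ends, no vertex lies in
the interior of an edge, and the interiors of distinct edges are disjoint. -/
structure PlaneEmbedding {V : Type*} (G : SimpleGraph V) where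
  /-- The points that represent the vertices. -/
  point : V → EuclideanSpace ℝ (Fin 2)
  /-- The arcs that represent the edges, parametrized by `[0, 1]`. -/
  arc : G.edgeSet → unitInterval → EuclideanSpace ℝ (Fin 2)
  point_injective : Function.Injective point
  arc_continuous : ∀ e, Continuous (arc e)
  arc_injective : ∀ e, Function.Injective (arc e)
  arc_ends : ∀ e : G.edgeSet, s(arc e 0, arc e 1) = Sym2.map point (e : Sym2 V)
  arc_avoids_points : ∀ e, ∀ t ∈ Set.Ioo (0 : unitInterval) 1, ∀ v, arc e t ≠ point v
  arcs_disjoint : ∀ e f, e ≠ f →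
    Disjoint (arc e '' Set.Ioo (0 : unitInterval) 1) (arc f '' Set.Ioo (0 : unitInterval) 1)

/-- A graph is planar if it can be drawn in the plane without crossings. -/
def IsPlanar {V : Type*} (G : SimpleGraph V) : Prop :=
  Nonempty G.PlaneEmbedding

end SimpleGraph

/-!
In a `C₄`-free graph two distinct vertices have at most one common neighbour. Counting the edges
that meet the neighbourhood of `w` from their other end `v` therefore gives
`∑_{x ~ w} d(x) + 1 ≤ n + 2⌊d(w)/2⌋`: each `v ≠ w` contributes at most one, `w` contributes `d(w)`,
and by the handshake lemma the neighbours of `w` contribute an even number in total.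

On seven vertices with all degrees at most four, this inequality shows that every nonempty `C₄`-free
graph has an edge whose two degrees add up to at most five. By the Bondy–Chvátal closure theorem
(`isHamiltonian_of_sup_edge`), deleting such an edge does not affect whether the complement is
Hamiltonian; deleting all edges in this way reaches the complete graph, so the complement has a
7-cycle. On eight vertices two degrees add up to at most nine, so discarding a vertex of maximum
degree leaves this situation.

On eleven vertices, a vertex of degree at most two is a hub, with at least eight non-neighbours.
If all degrees are at least three, the inequality bounds them by four and provides a vertex of
degree exactly three; that vertex is a hub, with seven non-neighbours.
-/

open SimpleGraph Finset

section CommonNeighbors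

variable {V : Type*} {G : SimpleGraph V}

theorem eq_of_adj_of_free_cycleGraph_four (hG : (cycleGraph 4).Free G) {u v a b : V} (huv : u ≠ v)
    (hua : G.Adj u a) (hva : G.Adj v a) (hub : G.Adj u b) (hvb : G.Adj v b) : a = b := by
  by_contra hab
  let c : G.Walk u u := .cons hua (.cons hva.symm (.cons hvb (.cons hub.symm .nil)))
  have hc : c.IsCycle := by
    simp [c, Walk.cons_isCycle_iff, Walk.cons_isPath_iff, hua.ne, hua.ne', hva.ne',
      hub.ne, hub.ne', hvb.ne, huv, huv.symm, hab]
  exact hG ((cycleGraph_isContained_iff (by norm_num)).2 ⟨u, c, hc, rfl⟩)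

variable [Fintype V] [DecidableRel G.Adj]

theorem card_neighborFinset_inter_le_one [DecidableEq V] (hG : (cycleGraph 4).Free G) {u v : V}
    (huv : u ≠ v) :
    #(G.neighborFinset u ∩ G.neighborFinset v) ≤ 1 := by
  refine card_le_one.2 fun a ha b hb => ?_
  simp only [mem_inter, mem_neighborFinset] at ha hb
  exact eq_of_adj_of_free_cycleGraph_four hG huv ha.1 ha.2 hb.1 hb.2

theorem degree_add_degree_le (hG : (cycleGraph 4).Free G) {u v : V} (huv : u ≠ v) :
    G.degree u + G.degree v ≤ Fintype.card V + 1 := by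
  classical
  rw [← card_neighborFinset_eq_degree, ← card_neighborFinset_eq_degree,
    ← card_union_add_card_inter]
  exact add_le_add (card_le_univ _) (card_neighborFinset_inter_le_one hG huv)

theorem degree_induce_finset [DecidableEq V] (S : Finset V) (v : S) :
    (G.induce (S : Set V)).degree v = #(G.neighborFinset v ∩ S) := by
  rw [← card_neighborFinset_eq_degree, ← card_map (Function.Embedding.subtype _)]
  congr 1
  ext w
  simp

variable (G) in
theorem even_sum_card_neighborFinset_inter [DecidableEq V] (S : Finset V) :
    Even (∑ v ∈ S, #(G.neighborFinset v ∩ S)) := by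
  rw [← sum_coe_sort]
  simp_rw [← degree_induce_finset]
  have := (G.induce (S : Set V)).sum_degrees_eq_twice_card_edges
  exact even_iff_two_dvd.2 ⟨_, this⟩

variable (G) in
theorem sum_degree_neighborFinset [DecidableEq V] (w : V) :
    ∑ x ∈ G.neighborFinset w, G.degree x = ∑ v, #(G.neighborFinset v ∩ G.neighborFinset w) := by
  have := sum_card_bipartiteAbove_eq_sum_card_bipartiteBelow (s := G.neighborFinset w)
    (t := univ) G.Adj
  convert this using 2 with x _ v _
  · simp [bipartiteAbove, ← card_neighborFinset_eq_degree, neighborFinset_eq_filter]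
  · congr 1
    ext
    simp [bipartiteBelow, adj_comm, and_comm]

theorem sum_degree_neighborFinset_add_one_le (hG : (cycleGraph 4).Free G) (w : V) :
    ∑ x ∈ G.neighborFinset w, G.degree x + 1 ≤ Fintype.card V + 2 * (G.degree w / 2) := by
  classical
  set N := G.neighborFinset w with hN
  have hinner : ∑ v ∈ N, #(G.neighborFinset v ∩ N) ≤ 2 * (G.degree w / 2) := by
    obtain ⟨k, hk⟩ := even_sum_card_neighborFinset_inter G N
    have : ∑ v ∈ N, #(G.neighborFinset v ∩ N) ≤ #N := by
      refine (sum_le_card_nsmul N _ 1 fun v hv => ?_).trans_eq (mul_one _)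
      exact card_neighborFinset_inter_le_one hG ((G.mem_neighborFinset w v).1 hv).ne'
    rw [card_neighborFinset_eq_degree] at this
    omega
  have houter : ∑ v ∈ Nᶜ.erase w, #(G.neighborFinset v ∩ N) ≤ #(Nᶜ.erase w) := by
    refine (sum_le_card_nsmul _ _ 1 fun v hv => ?_).trans_eq (mul_one _)
    exact card_neighborFinset_inter_le_one hG (ne_of_mem_erase hv)
  have hw : w ∈ Nᶜ := by simp [N]
  rw [card_erase_of_mem hw, card_compl, card_neighborFinset_eq_degree] at houter
  rw [sum_degree_neighborFinset, ← sum_add_sum_compl N, ← add_sum_erase _ _ hw, ← hN, inter_self,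
    card_neighborFinset_eq_degree]
  have := G.degree_lt_card_verts w
  omega

theorem mul_degree_add_one_le_of_forall_adj (hG : (cycleGraph 4).Free G) {w : V} {k : ℕ}
    (hk : ∀ x, G.Adj w x → k ≤ G.degree x) :
    k * G.degree w + 1 ≤ Fintype.card V + 2 * (G.degree w / 2) := by
  have hsum : k * G.degree w ≤ ∑ x ∈ G.neighborFinset w, G.degree x := by
    rw [mul_comm, ← card_neighborFinset_eq_degree]
    exact card_nsmul_le_sum _ _ _ fun x hx => hk x ((G.mem_neighborFinset w x).1 hx)
  have := sum_degree_neighborFinset_add_one_le hG w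
  omega

theorem adj_of_card_le_degree_add_degree (hG : (cycleGraph 4).Free G) {u v : V} (huv : u ≠ v)
    (hdeg : Fintype.card V ≤ G.degree u + G.degree v) : G.Adj u v := by
  classical
  by_contra hnadj
  have hunion : #(G.neighborFinset u ∪ G.neighborFinset v) ≤ Fintype.card V - 2 := by
    rw [← card_pair huv, ← card_compl]
    refine card_le_card (subset_compl_iff_disjoint_right.2 ?_)
    simp [disjoint_insert_right, adj_comm, hnadj]
  have hinter := card_neighborFinset_inter_le_one hG huv
  have hsum := card_union_add_card_inter (G.neighborFinset u) (G.neighborFinset v)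
  rw [card_neighborFinset_eq_degree, card_neighborFinset_eq_degree] at hsum
  have := Fintype.one_lt_card_iff.2 ⟨u, v, huv⟩
  omega

end CommonNeighbors

section Hamiltonian

variable {V : Type*} [DecidableEq V] {H : SimpleGraph V} {u v : V}

theorem isHamiltonian_take_append_reverse_drop {p : H.Walk u v} (hp : p.IsHamiltonian) {i : ℕ}
    (hi : i < p.length) (h : H.Adj (p.getVert i) v) :
    ((p.take i).append ((p.drop (i + 1)).reverse.cons h)).IsHamiltonian := by
  intro w
  have hsupport : p.support = (p.take i).support ++ (p.drop (i + 1)).support := by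
    rw [Walk.support_take, Walk.drop_support_eq_support_drop_min, min_eq_left hi,
      List.take_append_drop]
  have hw := hp w
  rw [hsupport, List.count_append] at hw
  rwa [Walk.support_append, List.count_append, Walk.support_cons, List.tail_cons,
    Walk.support_reverse, List.count_reverse]

theorem exists_isHamiltonian_walk_notMem_edges {C : H.Walk u u} (hC : C.IsHamiltonianCycle)
    (hv : s(u, v) ∈ C.edges) : ∃ p : H.Walk v u, p.IsHamiltonian ∧ s(u, v) ∉ p.edges := by
  wlog hsnd : C.snd = v generalizing C with hrec
  · have : Finite V := hC.finite
    have : Fintype V := Fintype.ofFinite V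
    have hadj : v ∈ C.toSubgraph.neighborSet u := C.mem_edges_toSubgraph.2 hv
    rw [hC.isCycle.neighborSet_toSubgraph_endpoint] at hadj
    refine hrec (C := C.reverse) ?_ (by simpa using hv) ?_
    · rw [Walk.isHamiltonianCycle_iff_isCycle_and_length_eq]
      exact ⟨hC.isCycle.reverse, by rw [Walk.length_reverse, hC.length_eq]⟩
    · rw [Walk.snd_reverse]
      exact (hadj.resolve_left fun h => hsnd h.symm).symm
  cases C with
  | nil => exact absurd rfl hC.isCycle.ne_nil
  | cons h p =>
    rw [Walk.snd_cons] at hsnd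
    subst hsnd
    exact ⟨p, fun w => by simpa using hC.isHamiltonian_tail w,
      ((p.cons_isCycle_iff h).1 hC.isCycle).2⟩

variable [Fintype V]

theorem isHamiltonian_of_isHamiltonian_walk_of_adj {p : H.Walk u v} (hp : p.IsHamiltonian)
    (hvu : H.Adj v u) (hV : 3 ≤ Fintype.card V) : H.IsHamiltonian := by
  have hcycle : (p.cons hvu).IsCycle :=
    (p.cons hvu).isCycle_iff_isPath_tail_and_le_length.2
      ⟨by simpa using hp.isPath, by rw [Walk.length_cons, hp.length_eq]; omega⟩
  refine fun _ => ⟨v, p.cons hvu, Walk.isHamiltonianCycle_iff_isCycle_and_length_eq.2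
    ⟨hcycle, ?_⟩⟩
  rw [Walk.length_cons, hp.length_eq]
  omega

theorem exists_adj_getVert_of_card_le_degree_add_degree [DecidableRel H.Adj] {p : H.Walk u v}
    (hp : p.IsHamiltonian)
    (hdeg : Fintype.card V ≤ H.degree u + H.degree v) :
    ∃ i < p.length, H.Adj u (p.getVert (i + 1)) ∧ H.Adj (p.getVert i) v := by
  let A := {i ∈ range p.length | H.Adj u (p.getVert (i + 1))}
  let B := {i ∈ range p.length | H.Adj (p.getVert i) v}
  have hA : H.degree u ≤ #A := by
    rw [← card_neighborFinset_eq_degree]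
    refine (card_le_card fun w hw => ?_).trans
      (card_image_le (s := A) (f := fun i => p.getVert (i + 1)))
    obtain ⟨j, rfl, hj⟩ := p.mem_support_iff_exists_getVert.1 (hp.mem_support w)
    rw [mem_neighborFinset] at hw
    obtain _ | i := j
    · simp at hw
    · exact mem_image_of_mem (fun i => p.getVert (i + 1)) (mem_filter.2 ⟨mem_range.2 hj, hw⟩)
  have hB : H.degree v ≤ #B := by
    rw [← card_neighborFinset_eq_degree]
    refine (card_le_card fun w hw => ?_).trans (card_image_le (s := B) (f := p.getVert))
    obtain ⟨j, rfl, hj⟩ := p.mem_support_iff_exists_getVert.1 (hp.mem_support w)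
    rw [mem_neighborFinset] at hw
    have hj' : j ≠ p.length := by
      rintro rfl
      simp at hw
    exact mem_image_of_mem p.getVert
      (mem_filter.2 ⟨mem_range.2 (lt_of_le_of_ne hj hj'), hw.symm⟩)
  have hcard : #(range p.length) < #A + #B := by
    have := Fintype.card_pos_iff.2 ⟨u⟩
    rw [card_range, hp.length_eq]
    omega
  obtain ⟨i, hi⟩ := inter_nonempty_of_card_lt_card_add_card
    (filter_subset _ _) (filter_subset _ _) hcard
  obtain ⟨hiA, hiB⟩ := mem_inter.1 hi
  obtain ⟨hi, hu⟩ := mem_filter.1 hiA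
  exact ⟨i, mem_range.1 hi, hu, (mem_filter.1 hiB).2⟩

theorem isHamiltonian_of_isHamiltonian_walk_of_card_le_degree_add_degree [DecidableRel H.Adj]
    {p : H.Walk u v} (hp : p.IsHamiltonian) (hV : 3 ≤ Fintype.card V)
    (hdeg : Fintype.card V ≤ H.degree u + H.degree v) : H.IsHamiltonian := by
  obtain ⟨i, hi, hu, hv⟩ := exists_adj_getVert_of_card_le_degree_add_degree hp hdeg
  exact isHamiltonian_of_isHamiltonian_walk_of_adj
    (isHamiltonian_take_append_reverse_drop hp hi hv) hu.symm hV

theorem isHamiltonian_or_exists_isHamiltonian_walk_of_sup_edge [Nontrivial V]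
    (hH : (H ⊔ edge u v).IsHamiltonian) :
    H.IsHamiltonian ∨ ∃ p : H.Walk v u, p.IsHamiltonian := by
  have hmem : ∀ e ∈ (H ⊔ edge u v).edgeSet, e ≠ s(u, v) → e ∈ H.edgeSet := by
    intro e he hne
    rw [edgeSet_sup] at he
    exact he.resolve_right fun he => hne (edgeSet_edge_subset he)
  obtain ⟨C, hC⟩ := hH.exists_isHamiltonianCycle u
  by_cases huv : s(u, v) ∈ C.edges
  · obtain ⟨p, hp, hpuv⟩ := exists_isHamiltonian_walk_notMem_edges hC huv
    refine .inr ⟨p.transfer H fun e he => hmem e (p.edges_subset_edgeSet he) ?_, ?_⟩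
    · exact ne_of_mem_of_not_mem he hpuv
    · intro w
      rw [Walk.support_transfer]
      exact hp w
  · have hCH : ∀ e ∈ C.edges, e ∈ H.edgeSet := fun e he =>
      hmem e (C.edges_subset_edgeSet he) (ne_of_mem_of_not_mem he huv)
    refine .inl fun _ => ⟨u, C.transfer H hCH, ?_⟩
    rw [Walk.isHamiltonianCycle_iff_isCycle_and_length_eq, Walk.length_transfer]
    exact ⟨hC.isCycle.transfer hCH, hC.length_eq⟩

theorem isHamiltonian_of_sup_edge [DecidableRel H.Adj] (hV : 3 ≤ Fintype.card V)
    (hdeg : Fintype.card V ≤ H.degree u + H.degree v) (hH : (H ⊔ edge u v).IsHamiltonian) :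
    H.IsHamiltonian := by
  have : Nontrivial V := Fintype.one_lt_card_iff_nontrivial.1 (by omega)
  obtain hH | ⟨p, hp⟩ := isHamiltonian_or_exists_isHamiltonian_walk_of_sup_edge hH
  · exact hH
  · exact isHamiltonian_of_isHamiltonian_walk_of_card_le_degree_add_degree hp hV (by omega)

theorem compl_isHamiltonian_of_deleteEdges {G : SimpleGraph V} [DecidableRel G.Adj]
    (hV : 3 ≤ Fintype.card V) (hdeg : G.degree u + G.degree v + 2 ≤ Fintype.card V)
    (hG : (G.deleteEdges {s(u, v)})ᶜ.IsHamiltonian) : Gᶜ.IsHamiltonian := by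
  refine isHamiltonian_of_sup_edge (u := u) (v := v) hV ?_ (hG.mono fun a b hab => ?_)
  · rw [degree_compl, degree_compl]
    omega
  · simp only [compl_adj, deleteEdges_adj, Set.mem_singleton_iff, not_and, not_not, sup_adj,
      edge_adj] at hab ⊢
    by_cases h : G.Adj a b
    · exact .inr ⟨by simpa using hab.2 h, hab.1⟩
    · exact .inl ⟨hab.1, h⟩

theorem isHamiltonian_iff_cycleGraph_isContained (hV : 3 ≤ Fintype.card V) :
    H.IsHamiltonian ↔ cycleGraph (Fintype.card V) ⊑ H := by
  simp only [cycleGraph_isContained_iff hV, IsHamiltonian,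
    Walk.isHamiltonianCycle_iff_isCycle_and_length_eq]
  exact ⟨fun h => h (by omega), fun h _ => h⟩

theorem compl_isHamiltonian_of_forall_le_exists_adj {G : SimpleGraph V}
    (hV : 3 ≤ Fintype.card V)
    (hG : ∀ (G' : SimpleGraph V) [DecidableRel G'.Adj], G' ≤ G → G' ≠ ⊥ →
      ∃ u v, G'.Adj u v ∧ G'.degree u + G'.degree v + 2 ≤ Fintype.card V) :
    Gᶜ.IsHamiltonian := by
  classical
  induction G using WellFoundedLT.induction with
  | ind G ih =>
    obtain rfl | hne := eq_or_ne G ⊥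
    · rw [compl_bot, isHamiltonian_iff_cycleGraph_isContained hV]
      exact isContained_top_iff.2 ⟨(Fintype.equivFin V).symm.toEmbedding⟩
    · obtain ⟨u, v, huv, hdeg⟩ := hG G le_rfl hne
      have hlt : G.deleteEdges {s(u, v)} < G :=
        (G.deleteEdges_le _).lt_of_not_ge fun hle => by simpa using hle huv
      exact compl_isHamiltonian_of_deleteEdges hV hdeg
        (ih _ hlt fun G' _ hG' => hG G' (hG'.trans hlt.le))

end Hamiltonian

section SevenVertices

variable {V : Type*} [Fintype V] {G : SimpleGraph V} [DecidableRel G.Adj]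

theorem degree_eq_four_or_degree_eq_four_of_adj (hV : Fintype.card V ≤ 7)
    (hG : (cycleGraph 4).Free G) (hΔ : ∀ v, G.degree v ≤ 4)
    (h6 : ∀ u v, G.Adj u v → 6 ≤ G.degree u + G.degree v) {u v : V} (huv : G.Adj u v) :
    G.degree u = 4 ∨ G.degree v = 4 := by
  have hthree : ∀ w, G.degree w ≠ 3 := fun w hw => by
    have := mul_degree_add_one_le_of_forall_adj hG (w := w) (k := 3) fun x hwx => by
      have := h6 w x hwx
      omega
    omega
  have := h6 u v huv
  have := hΔ u
  have := hΔ v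
  have := hthree u
  have := hthree v
  omega

theorem card_filter_neighborFinset_degree_eq_four_le_one (hV : Fintype.card V ≤ 7)
    (hG : (cycleGraph 4).Free G) (h6 : ∀ u v, G.Adj u v → 6 ≤ G.degree u + G.degree v)
    {u : V} (hu : G.degree u = 4) :
    #{x ∈ G.neighborFinset u | G.degree x = 4} ≤ 1 := by
  have hsum := sum_degree_neighborFinset_add_one_le hG u
  have hle : ∑ x ∈ G.neighborFinset u, (2 + if G.degree x = 4 then 2 else 0) ≤
      ∑ x ∈ G.neighborFinset u, G.degree x := by
    refine sum_le_sum fun x hx => ?_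
    have := h6 u x ((G.mem_neighborFinset u x).1 hx)
    split_ifs <;> omega
  rw [sum_add_distrib, ← sum_filter, sum_const, sum_const, card_neighborFinset_eq_degree,
    smul_eq_mul, smul_eq_mul] at hle
  omega

theorem exists_adj_degree_add_degree_le_five (hV : Fintype.card V ≤ 7)
    (hG : (cycleGraph 4).Free G) (hΔ : ∀ v, G.degree v ≤ 4) (hne : G ≠ ⊥) :
    ∃ u v, G.Adj u v ∧ G.degree u + G.degree v ≤ 5 := by
  by_contra! h6
  have hfour {u v : V} := degree_eq_four_or_degree_eq_four_of_adj hV hG hΔ h6 (u := u) (v := v)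
  obtain ⟨u, hu⟩ : ∃ u, G.degree u = 4 := by
    obtain ⟨a, b, hab⟩ := ne_bot_iff_exists_adj.1 hne
    exact (hfour hab).elim (fun h => ⟨a, h⟩) fun h => ⟨b, h⟩
  let D := {x ∈ G.neighborFinset u | G.degree x = 4}
  let A := {x ∈ G.neighborFinset u | ¬G.degree x = 4}
  have hD : #D ≤ 1 := card_filter_neighborFinset_degree_eq_four_le_one hV hG h6 hu
  have hA : 1 < #A := by
    have : #D + #A = #(G.neighborFinset u) := card_filter_add_card_filter_not _
    rw [card_neighborFinset_eq_degree] at this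
    omega
  -- Vertices of degree four are pairwise adjacent, so the second neighbour of `a` that `h6` forces
  -- lies in `D`; since `D` has at most one element, it is the same for all `a ∈ A`.
  have hcommon : ∀ a ∈ A, ∃ z ∈ D, G.Adj z a := by
    intro a ha
    obtain ⟨hua, ha4⟩ : G.Adj u a ∧ G.degree a ≠ 4 := by simpa [A] using ha
    have hdega : 1 < #(G.neighborFinset a) := by
      have := h6 u a hua
      rw [card_neighborFinset_eq_degree]
      omega
    obtain ⟨z, hz, hzu⟩ := exists_mem_ne hdega u
    have haz : G.Adj a z := (G.mem_neighborFinset a z).1 hz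
    have hz4 : G.degree z = 4 := (hfour haz).resolve_left ha4
    have huz : G.Adj u z := adj_of_card_le_degree_add_degree hG hzu.symm (by omega)
    exact ⟨z, by simp [D, huz, hz4], haz.symm⟩
  obtain ⟨a, ha, b, hb, hab⟩ := one_lt_card.1 hA
  obtain ⟨z, hzD, hza⟩ := hcommon a ha
  obtain ⟨z', hzD', hzb⟩ := hcommon b hb
  obtain rfl : z = z' := card_le_one.1 hD z hzD z' hzD'
  simp only [A, D, mem_filter, mem_neighborFinset] at ha hb hzD
  exact hab (eq_of_adj_of_free_cycleGraph_four hG hzD.1.ne ha.1 hza hb.1 hzb)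

theorem cycleGraph_seven_isContained_compl_of_degree_le_four (hV : Fintype.card V = 7)
    (hG : (cycleGraph 4).Free G) (hΔ : ∀ v, G.degree v ≤ 4) : cycleGraph 7 ⊑ Gᶜ := by
  classical
  have hham : Gᶜ.IsHamiltonian := by
    refine compl_isHamiltonian_of_forall_le_exists_adj (by omega) fun G' _ hle hne => ?_
    obtain ⟨u, v, huv, hdeg⟩ := exists_adj_degree_add_degree_le_five hV.le
      (fun h => hG (h.mono_right hle)) (fun v => (degree_le_of_le hle).trans (hΔ v)) hne
    exact ⟨u, v, huv, by omega⟩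
  rw [isHamiltonian_iff_cycleGraph_isContained (by omega)] at hham
  rwa [hV] at hham

end SevenVertices

section Induced

variable {V : Type*}

theorem compl_induce_isContained (G : SimpleGraph V) (s : Set V) : (G.induce s)ᶜ ⊑ Gᶜ :=
  (Embedding.induce s).isIndContained.compl.isContained

theorem free_induce {W : Type*} {H : SimpleGraph W} {G : SimpleGraph V} (hG : H.Free G)
    (s : Set V) : H.Free (G.induce s) :=
  fun h => hG (h.trans ⟨Copy.induce G s⟩)

theorem exists_isIndContained_of_le_card [Fintype V] (G : SimpleGraph V) {n : ℕ}
    (hn : n ≤ Fintype.card V) : ∃ H : SimpleGraph (Fin n), H ⊴ G := by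
  obtain ⟨f⟩ : Nonempty (Fin n ↪ V) := Function.Embedding.nonempty_of_card_le (by simpa using hn)
  exact ⟨G.comap f, ⟨Embedding.comap f G⟩⟩

theorem wheelGraph_isContained_of_cycleGraph_isContained {n : ℕ} {G : SimpleGraph V} {v : V}
    (h : cycleGraph n ⊑ G.induce (G.neighborSet v)) : wheelGraph n ⊑ G := by
  obtain ⟨f⟩ := h
  let φ : Option (Fin n) → V := fun o => o.elim v fun i => f i
  have hub : ∀ i, G.Adj v (f i) := fun i => (f i).2
  refine ⟨⟨⟨φ, ?_⟩, ?_⟩⟩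
  · rintro (_ | i) (_ | j) hij
    · exact hij.elim
    · exact hub j
    · exact (hub i).symm
    · exact f.toHom.map_adj hij
  · rintro (_ | i) (_ | j) hij
    · rfl
    · exact absurd hij (hub j).ne
    · exact absurd hij (hub i).ne'
    · exact congrArg some (f.injective (Subtype.ext hij))

theorem wheelGraph_isContained_compl_of_cycleGraph_isContained {n : ℕ} {G : SimpleGraph V} {v : V}
    (h : cycleGraph n ⊑ (G.induce (Gᶜ.neighborSet v))ᶜ) : wheelGraph n ⊑ Gᶜ := by
  refine wheelGraph_isContained_of_cycleGraph_isContained (v := v) (h.mono_right fun a b hab => ?_)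
  simpa [Subtype.ext_iff] using hab

end Induced

section EightVertices

variable {V : Type*} [Fintype V] {G : SimpleGraph V}

theorem cycleGraph_seven_isContained_compl_of_card_eq_eight (hV : Fintype.card V = 8)
    (hG : (cycleGraph 4).Free G) : cycleGraph 7 ⊑ Gᶜ := by
  classical
  have : Nonempty V := Fintype.card_pos_iff.1 (by omega)
  obtain ⟨w, hw⟩ := G.exists_maximal_degree_vertex
  have hdeg : ∀ v ≠ w, G.degree v ≤ 4 := fun v hvw => by
    have := degree_add_degree_le hG hvw
    have := G.degree_le_maxDegree v
    omega
  refine (cycleGraph_seven_isContained_compl_of_degree_le_four (G := G.induce {w}ᶜ) ?_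
    (free_induce hG _) fun v => ?_).trans (compl_induce_isContained G _)
  · rw [Fintype.card_compl_set, hV, Set.card_singleton]
  · exact ((Copy.induce G _).degree_le v).trans (hdeg v v.2)

theorem cycleGraph_seven_isContained_compl (hV : 8 ≤ Fintype.card V)
    (hG : (cycleGraph 4).Free G) : cycleGraph 7 ⊑ Gᶜ := by
  obtain ⟨H, hH⟩ := exists_isIndContained_of_le_card G hV
  exact (cycleGraph_seven_isContained_compl_of_card_eq_eight (Fintype.card_fin 8)
    fun h => hG (h.trans hH.isContained)).trans hH.compl.isContained

end EightVertices

section ElevenVertices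

variable {V : Type*} [Fintype V] {G : SimpleGraph V}

theorem exists_degree_le_three [Nonempty V] [DecidableRel G.Adj] (hV : Fintype.card V ≤ 11)
    (hG : (cycleGraph 4).Free G) : ∃ v, G.degree v ≤ 3 := by
  by_contra! hδ
  obtain ⟨w⟩ := ‹Nonempty V›
  have := mul_degree_add_one_le_of_forall_adj hG (w := w) fun x _ => hδ x
  have := hδ w
  omega

theorem degree_le_four_of_forall_three_le [DecidableRel G.Adj] (hV : Fintype.card V ≤ 11)
    (hG : (cycleGraph 4).Free G) (hδ : ∀ v, 3 ≤ G.degree v) (w : V) : G.degree w ≤ 4 := by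
  have := mul_degree_add_one_le_of_forall_adj hG (w := w) fun x _ => hδ x
  omega

theorem wheelGraph_seven_isContained_compl_of_card_eq_eleven (hV : Fintype.card V = 11)
    (hG : (cycleGraph 4).Free G) : wheelGraph 7 ⊑ Gᶜ := by
  classical
  have hcard : ∀ v, Fintype.card (Gᶜ.neighborSet v) = 10 - G.degree v := fun v => by
    rw [card_neighborSet_eq_degree, degree_compl, hV]
  by_cases hδ : ∀ v, 3 ≤ G.degree v
  · have : Nonempty V := Fintype.card_pos_iff.1 (by omega)
    obtain ⟨v, hv⟩ := exists_degree_le_three hV.le hG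
    have hfar : Fintype.card (Gᶜ.neighborSet v) = 7 := by
      rw [hcard, hv.antisymm (hδ v)]
    exact wheelGraph_isContained_compl_of_cycleGraph_isContained
      (cycleGraph_seven_isContained_compl_of_degree_le_four hfar (free_induce hG _) fun x =>
        ((Copy.induce G _).degree_le x).trans
          (degree_le_four_of_forall_three_le hV.le hG hδ x))
  · push Not at hδ
    obtain ⟨v, hv⟩ := hδ
    have hfar : 8 ≤ Fintype.card (Gᶜ.neighborSet v) := by
      rw [hcard]
      omega
    exact wheelGraph_isContained_compl_of_cycleGraph_isContained
      (cycleGraph_seven_isContained_compl hfar (free_induce hG _))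

theorem mainTheorem6_general (hV : 11 ≤ Fintype.card V) (hG : (cycleGraph 4).Free G) :
    wheelGraph 7 ⊑ Gᶜ := by
  obtain ⟨H, hH⟩ := exists_isIndContained_of_le_card G hV
  exact (wheelGraph_seven_isContained_compl_of_card_eq_eleven (Fintype.card_fin 11)
    fun h => hG (h.trans hH.isContained)).trans hH.compl.isContained

end ElevenVertices

theorem mainTheorem6 {V : Type*} [Fintype V] (hV : Fintype.card V = 11)
    (G : SimpleGraph V) (hplanar : G.IsPlanar) (hC4 : (SimpleGraph.cycleGraph 4).Free G) :
    (SimpleGraph.wheelGraph 7).IsContained Gᶜ :=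
  mainTheorem6_general hV.ge hC4
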